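/- \textbf{Setting.} Let $S$ be a countable set with the $\sigma$-algebra $2^S$, let $\mu$ be a probability measure on $S$ and $P$ a transition probability kernel on $S$. Let $\mathsf P_\mu$ be the law on $S^{\mathbb N}$ of the time-homogeneous Markov chain $\Phi=(\Phi_0,\Phi_1,\dots)$ with initial distribution $\mu$ and transition kernel $P$. For $A\subseteq S$ put $$\mathrm{Fin}(A)=\bigcup_{n}\bigcap_{m\ge n}\{\Phi_m\notin A\},\qquad \mathrm{Inf}(A)=\bigcap_{n}\bigcup_{m\ge n}\{\Phi_m\in A\}.$$ For $V:S\to\mathbb R_{\ge0}$ write $PV(s)=\int_S V(u)\,P(s,\mathrm du)$ and $\mu V=\int_S V\,\mathrm d\mu$. Let $(A_1,B_1),\dots,(A_k,B_k)$ be pairs of subsets of $S$ (a Streett acceptance condition). \textbf{Theorem (Proof Rule \#2 is complete for almost-sure reactivity).} Suppose that $$\mathsf P_\mu\Big(\bigcap_{i=1}^k \big(\mathrm{Fin}(A_i)\cup \mathrm{Inf}(B_i)\big)\Big)=1 .$$ Then there exist a set $I\subseteq S$ (supporting invariant) and a function $V_0:S\to\mathbb R_{\ge0}$, sets $J_i\subseteq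 I\setminus A_i$ (absorbing regions), functions $V_i,W_i:S\to\mathbb R_{\ge0}$ (supermartingale certificates), $d_i:\mathbb R_{\ge0}\to\mathbb R_{>0}$ (decrease functions) and $p_i:\mathbb R_{\ge0}\to(0,1]$ (probability functions), for $i=1,\dots,k$, with $PV_0$, $PV_i$, $PW_i$ finite everywhere on $S$, such that $\mu V_0=0$ and the following conditions of Proof Rule \#2 hold. \begin{enumerate} \item \emph{Qualitative safety}, for every $i=1,\dots,k$: (a) $PV_i(s)\le V_i(s)$ for all $s\notin A_i$; (b) $V_i(s)\ge 1$ for all $s\in A_i$; (c) there is $\gamma_i>0$ with $V_i(s)\le 1-\gamma_i$ for all $s\in J_i$. \item \emph{Almost-sure termination}, for every $i=1,\dots,k$: (a) $W_i(s)>0$ for all $s\in I\setminus(B_i\cup J_i)$; (b) $W_i(s)=0$ for all $s\in I\cap(B_i\cup J_i)$; (c) $PW_i(s)\le W_i(s)$ for all $s\in I\setminus(B_i\cup J_i)$; (d) for all $r>0$ and all $s\in I\setminus(B_i\cup J_i)$ with $W_i(s)=r$: $P\big(s,\{s':W_i(s')\le r-d_i(r)\}\big)\ge p_i(r)$; (e)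 $p_i(r_1)\ge p_i(r_2)$ and $d_i(r_1)\ge d_i(r_2)$ whenever $0<r_1\le r_2$. \item \emph{Quantitative safety}: (a) $PV_0(s)\le V_0(s)$ for all $s\in I$; (b) $V_0(s)\ge1$ for all $s\notin I$. \end{enumerate} -/

import Mathlib

open MeasureTheory ProbabilityTheory
open scoped NNReal ENNReal

namespace StreettChain

noncomputable section

variable {S : Type*}

/-- The event of visiting the region `A` only finitely many times. -/
def finVisits (A : Set S) : Set (ℕ → S) := ⋃ n : ℕ, ⋂ m : ℕ, ⋂ _ : n ≤ m, {ω | ω m ∉ A}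

/-- The event of visiting the region `A` infinitely many times. -/
def infVisits (A : Set S) : Set (ℕ → S) := ⋂ n : ℕ, ⋃ m : ℕ, ⋃ _ : n ≤ m, {ω | ω m ∈ A}

/-- The reactivity property of the Streett acceptance condition `(A i, B i)`, `i < k`. -/
def reactivity {k : ℕ} (A B : Fin k → Set S) : Set (ℕ → S) :=
  ⋂ i : Fin k, (finVisits (A i) ∪ infVisits (B i))

variable [MeasurableSpace S]

/-- The law, on the space of infinite trajectories, of the time-homogeneous Markov chain with
initial distribution `μ` and transition kernel `P`. -/
def pathMeasure (μ : Measure S) [IsProbabilityMeasure μ] (P : Kernel S S) [IsMarkovKernel P] :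
    Measure (ℕ → S) :=
  Kernel.trajMeasure (X := fun _ : ℕ => S) μ
    (fun n => P.comap (fun x : (Finset.Iic n → S) => x ⟨n, Finset.mem_Iic.2 le_rfl⟩)
      (measurable_pi_apply _))

/-- The init-expectation `μV`. -/
def initExp (μ : Measure S) (V : S → ℝ≥0) : ℝ≥0∞ := ∫⁻ u, (V u : ℝ≥0∞) ∂μ

/-- The post-expectation `PV`. -/
def postExp (P : Kernel S S) (V : S → ℝ≥0) (s : S) : ℝ≥0∞ := ∫⁻ u, (V u : ℝ≥0∞) ∂(P s)

/-- The requirements of the proof rule on a supporting invariant `I` with `V₀`, absorbing regions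
`J i`, supermartingale certificates `V i`, `W i`, decrease functions `d i` and probability
functions `p i`, for the Streett acceptance condition `(A i, B i)`. -/
structure ProofRuleTwo (P : Kernel S S) {k : ℕ} (A B : Fin k → Set S)
    (I : Set S) (V₀ : S → ℝ≥0) (J : Fin k → Set S) (V W : Fin k → S → ℝ≥0)
    (d p : Fin k → ℝ≥0 → ℝ≥0) : Prop where
  -- post-expectations are functions with finite values
  post_V₀_lt_top : ∀ s, postExp P V₀ s < ∞
  post_V_lt_top : ∀ i s, postExp P (V i) s < ∞
  post_W_lt_top : ∀ i s, postExp P (W i) s < ∞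
  -- codomains of the decrease and probability functions, location of the absorbing regions
  d_pos : ∀ i r, 0 < d i r
  p_pos : ∀ i r, 0 < p i r
  p_le_one : ∀ i r, p i r ≤ 1
  absorbing_subset : ∀ i, J i ⊆ I \ A i
  -- qualitative safety
  V_post : ∀ i, ∀ s ∉ A i, postExp P (V i) s ≤ V i s
  V_ge_one : ∀ i, ∀ s ∈ A i, 1 ≤ V i s
  V_gap : ∀ i, ∃ γ : ℝ, 0 < γ ∧ ∀ s ∈ J i, (V i s : ℝ) ≤ 1 - γ
  -- almost-sure termination
  W_pos : ∀ i, ∀ s ∈ I \ (B i ∪ J i), 0 < W i s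
  W_zero : ∀ i, ∀ s ∈ I ∩ (B i ∪ J i), W i s = 0
  W_post : ∀ i, ∀ s ∈ I \ (B i ∪ J i), postExp P (W i) s ≤ W i s
  W_drift : ∀ i, ∀ r : ℝ≥0, 0 < r → ∀ s ∈ I \ (B i ∪ J i), W i s = r →
    (p i r : ℝ≥0∞) ≤ P s {s' | (W i s' : ℝ) ≤ (r : ℝ) - (d i r : ℝ)}
  p_antitone : ∀ i, ∀ r₁ r₂ : ℝ≥0, 0 < r₁ → 0 < r₂ → r₁ ≤ r₂ → p i r₂ ≤ p i r₁
  d_antitone : ∀ i, ∀ r₁ r₂ : ℝ≥0, 0 < r₁ → 0 < r₂ → r₁ ≤ r₂ → d i r₂ ≤ d i r₁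
  -- quantitative safety
  V₀_post : ∀ s ∈ I, postExp P V₀ s ≤ V₀ s
  V₀_ge_one : ∀ s ∉ I, 1 ≤ V₀ s

end

end StreettChain

/-!
Take `I` to be the set of states visited with positive probability, `V₀` the indicator of its
complement, `Vᵢ` the probability of ever hitting `Aᵢ`, and `Jᵢ` the states of `I` where this
probability is at most one half. Along a path that stays in `Cᵢ = I \ (Bᵢ ∪ Jᵢ)`, a visit to `Aᵢ`
is always at least as likely as not, so `Aᵢ` is visited infinitely often although `Bᵢ` is not. By
reactivity the chain therefore almost surely leaves `Cᵢ`.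

On such a set `C` the ranking function is `W = H + G`. Here `H` is a sum of the probabilities of
reaching ever smaller cofinite sets before leaving `C`: it is superharmonic on `C`, and it has
finite sublevel sets because more and more summands equal `1` far out. The bounded function `G` is a
geometrically weighted sum of the probabilities of staying in `C` for `n` steps, and makes the
mean of `W` decrease strictly in every state of `C`. So from each of them `W` decreases by a
positive amount with positive probability, and finiteness of the sublevel sets allows both to be
bounded below by decreasing functions of the value of `W`.
-/

open Filter Topology

namespace StreettChain

section Sequences

lemma tsum_ne_top_of_eventually_le {x y : ℕ → ℝ≥0∞} (hx : ∀ j, x j ≠ ∞) (hy : ∑' j, y j ≠ ∞)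
    (hxy : ∀ᶠ j in atTop, x j ≤ y j) : ∑' j, x j ≠ ∞ := by
  obtain ⟨N, hN⟩ := eventually_atTop.1 hxy
  rw [← ENNReal.summable.sum_add_tsum_nat_add' (f := x) (k := N)]
  refine ENNReal.add_ne_top.2 ⟨ENNReal.sum_ne_top.2 fun j _ => hx j, ne_top_of_le_ne_top hy ?_⟩
  calc ∑' j, x (j + N) ≤ ∑' j, y (j + N) := ENNReal.tsum_le_tsum fun j => hN _ (by lia)
    _ ≤ ∑' j, y j := ENNReal.tsum_comp_le_tsum_of_injective (add_left_injective N) y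

lemma exists_seq_forall_tsum_ne_top {ι : Type*} [Countable ι] {x : ι → ℕ → ℝ≥0∞}
    (hx : ∀ i n, x i n ≠ ∞) (hlim : ∀ i, Tendsto (x i) atTop (𝓝 0)) :
    ∃ φ : ℕ → ℕ, ∀ i, ∑' j, x i (φ j) ≠ ∞ := by
  obtain ⟨code, hcode⟩ := Countable.exists_injective_nat ι
  have hsmall (j : ℕ) : ∃ n, ∀ i ∈ code ⁻¹' Set.Iic j, x i n ≤ 2⁻¹ ^ j :=
    ((eventually_all_finite ((Set.finite_Iic j).preimage hcode.injOn)).2 fun i _ =>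
      ENNReal.tendsto_nhds_zero.1 (hlim i) _ (ENNReal.pow_pos (by simp) j)).exists
  choose φ hφ using hsmall
  refine ⟨φ, fun i => tsum_ne_top_of_eventually_le (fun j => hx i (φ j)) ?_
    ((eventually_ge_atTop (code i)).mono fun j hj => hφ j i hj)⟩
  simp [ENNReal.tsum_geometric]

lemma exists_antitone_pos_le_comp {S β : Type*} [Preorder β] {C : Set S} {W : S → β}
    (hW : ∀ r, {s ∈ C | W s ≤ r}.Finite) {δ : S → ℝ≥0} (hδ : ∀ s ∈ C, 0 < δ s) :
    ∃ d : β → ℝ≥0, Antitone d ∧ (∀ r, 0 < d r) ∧ (∀ r, d r ≤ 1) ∧ ∀ s ∈ C, d (W s) ≤ δ s := by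
  let values (r : β) : Set ℝ≥0 := insert 1 (δ '' {s ∈ C | W s ≤ r})
  have hbdd (r : β) : BddBelow (values r) := OrderBot.bddBelow _
  refine ⟨fun r => sInf (values r), fun r₁ r₂ hr => ?_, fun r => ?_,
    fun r => csInf_le (hbdd r) (Set.mem_insert _ _),
    fun s hs => csInf_le (hbdd _) (Set.mem_insert_of_mem _ ⟨s, ⟨hs, le_rfl⟩, rfl⟩)⟩
  · exact csInf_le_csInf (hbdd _) (Set.insert_nonempty _ _) <| Set.insert_subset_insert <|
      Set.image_mono fun s hs => ⟨hs.1, hs.2.trans hr⟩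
  · have hmem : sInf (values r) ∈ values r :=
      (Set.insert_nonempty _ _).csInf_mem (((hW r).image δ).insert 1)
    have hpos : ∀ x ∈ values r, 0 < x := by
      rintro x (rfl | ⟨s, hs, rfl⟩)
      exacts [one_pos, hδ s hs.1]
    exact hpos _ hmem

lemma finite_setOf_tsum_le_natCast {S : Type*} {C : Set S} {F : ℕ → Set S} {u : ℕ → S → ℝ≥0∞}
    (hF : ∀ n, (F n)ᶜ.Finite) (hu : ∀ n, ∀ s ∈ C, s ∈ F n → u n s = 1) (m : ℕ) :
    {s ∈ C | ∑' n, u n s ≤ m}.Finite := by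
  refine ((Finset.range (m + 1)).finite_toSet.biUnion fun n _ => hF n).subset ?_
  rintro s ⟨hs, hle⟩
  by_contra! hs_mem
  simp only [Set.mem_iUnion, Set.mem_compl_iff, not_exists, not_not] at hs_mem
  refine hle.not_gt ?_
  calc (m : ℝ≥0∞) < (m + 1 : ℕ) := by exact_mod_cast m.lt_succ_self
    _ = ∑ n ∈ Finset.range (m + 1), u n s := by
      rw [Finset.sum_congr rfl fun n hn => hu n s hs (hs_mem n hn)]
      simp
    _ ≤ ∑' n, u n s := ENNReal.sum_le_tsum _

end Sequences

section StayProb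

variable {S : Type*} [MeasurableSpace S]

/-- The probability that the first `n` states of the chain with transition kernel `P` started
in `s`, beginning with `s` itself, all lie in `C`. -/
noncomputable def stayProb (P : Kernel S S) (C : Set S) : ℕ → S → ℝ≥0∞
  | 0 => 1
  | n + 1 => C.indicator fun s => ∫⁻ u, stayProb P C n u ∂(P s)

/-- The probability that the chain with transition kernel `P` started in `s` never leaves `C`,
as the decreasing limit of the probabilities for finite horizons. -/
noncomputable def stayForeverProb (P : Kernel S S) (C : Set S) (s : S) : ℝ≥0∞ :=
  ⨅ n, stayProb P C n s

variable {P : Kernel S S} {C D : Set S} {s : S}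

@[simp]
lemma stayProb_zero (s : S) : stayProb P C 0 s = 1 := rfl

lemma stayProb_succ_of_mem (hs : s ∈ C) (n : ℕ) :
    stayProb P C (n + 1) s = ∫⁻ u, stayProb P C n u ∂(P s) :=
  Set.indicator_of_mem hs _

lemma stayProb_succ_of_notMem (hs : s ∉ C) (n : ℕ) : stayProb P C (n + 1) s = 0 :=
  Set.indicator_of_notMem hs _

lemma stayForeverProb_le_stayProb (n : ℕ) (s : S) : stayForeverProb P C s ≤ stayProb P C n s :=
  iInf_le _ n

lemma stayForeverProb_le_one (s : S) : stayForeverProb P C s ≤ 1 :=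
  stayForeverProb_le_stayProb 0 s

lemma stayForeverProb_of_notMem (hs : s ∉ C) : stayForeverProb P C s = 0 :=
  nonpos_iff_eq_zero.1 <|
    (stayForeverProb_le_stayProb 1 s).trans_eq (stayProb_succ_of_notMem hs 0)

lemma stayProb_mono_set (hCD : C ⊆ D) (n : ℕ) : stayProb P C n ≤ stayProb P D n := by
  induction n with
  | zero => exact le_rfl
  | succ n ih =>
    exact (Set.indicator_mono fun s => lintegral_mono ih).trans
      (Set.indicator_le_indicator_of_subset hCD fun _ => zero_le)

lemma stayForeverProb_mono_set (hCD : C ⊆ D) (s : S) :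
    stayForeverProb P C s ≤ stayForeverProb P D s :=
  iInf_mono fun n => stayProb_mono_set hCD n s

lemma measurable_stayProb (hC : MeasurableSet C) (n : ℕ) : Measurable (stayProb P C n) := by
  induction n with
  | zero => exact measurable_const
  | succ n ih => exact ih.lintegral_kernel.indicator hC

lemma measurable_stayForeverProb (hC : MeasurableSet C) : Measurable (stayForeverProb P C) :=
  .iInf (measurable_stayProb hC)

variable [IsMarkovKernel P]

lemma stayProb_le_one (n : ℕ) (s : S) : stayProb P C n s ≤ 1 := by
  induction n generalizing s with
  | zero => exact le_rfl
  | succ n ih =>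
    refine Set.indicator_apply_le' (fun _ => ?_) fun _ => zero_le
    calc ∫⁻ u, stayProb P C n u ∂(P s) ≤ ∫⁻ _, 1 ∂(P s) := lintegral_mono ih
      _ = 1 := by simp

lemma stayProb_one_of_mem (hs : s ∈ C) : stayProb P C 1 s = 1 := by
  simp [stayProb_succ_of_mem hs]

lemma antitone_stayProb (P : Kernel S S) [IsMarkovKernel P] (C : Set S) :
    Antitone (stayProb P C) := by
  refine antitone_nat_of_succ_le fun n => ?_
  induction n with
  | zero => exact stayProb_le_one 1
  | succ n ih => exact Set.indicator_mono fun s => lintegral_mono ih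

lemma tendsto_stayProb (s : S) :
    Tendsto (fun n => stayProb P C n s) atTop (𝓝 (stayForeverProb P C s)) :=
  tendsto_atTop_iInf fun _ _ hmn => antitone_stayProb P C hmn s

lemma lintegral_stayForeverProb_eq_iInf (ν : Measure S) [IsFiniteMeasure ν]
    (hC : MeasurableSet C) :
    ∫⁻ u, stayForeverProb P C u ∂ν = ⨅ n, ∫⁻ u, stayProb P C n u ∂ν :=
  lintegral_iInf (measurable_stayProb hC) (antitone_stayProb P C) (by simp)

lemma lintegral_stayForeverProb (hC : MeasurableSet C) (hs : s ∈ C) :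
    ∫⁻ u, stayForeverProb P C u ∂(P s) = stayForeverProb P C s := by
  have hanti : Antitone fun n => stayProb P C n s := fun _ _ hmn => antitone_stayProb P C hmn s
  calc ∫⁻ u, stayForeverProb P C u ∂(P s)
      = ⨅ n, stayProb P C (n + 1) s := by
        simp_rw [lintegral_stayForeverProb_eq_iInf _ hC, stayProb_succ_of_mem hs]
    _ = stayForeverProb P C s := hanti.iInf_nat_add 1

/-- Each further step inside `C` costs another factor: inductively, staying forever has at most
`c` times the probability of staying for `n` steps, and the limit `n → ∞` gives `x ≤ c * x`. -/
lemma stayForeverProb_eq_zero_of_le (hC : MeasurableSet C) {c : ℝ≥0∞} (hc : c < 1)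
    (hle : ∀ s ∈ C, stayForeverProb P C s ≤ c) (s : S) : stayForeverProb P C s = 0 := by
  have hmul (n : ℕ) (s : S) : stayForeverProb P C s ≤ c * stayProb P C n s := by
    induction n generalizing s with
    | zero =>
      by_cases hs : s ∈ C
      · simpa using hle s hs
      · simp [stayForeverProb_of_notMem hs]
    | succ n ih =>
      by_cases hs : s ∈ C
      · rw [← lintegral_stayForeverProb hC hs, stayProb_succ_of_mem hs,
          ← lintegral_const_mul _ (measurable_stayProb hC n)]
        exact lintegral_mono ih
      · simp [stayForeverProb_of_notMem hs]
  have hself : stayForeverProb P C s ≤ c * stayForeverProb P C s :=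
    ge_of_tendsto' (ENNReal.Tendsto.const_mul (tendsto_stayProb s) (.inr hc.ne_top))
      fun n => hmul n s
  have hne_top : stayForeverProb P C s ≠ ∞ := ((stayForeverProb_le_one s).trans_lt (by simp)).ne
  by_contra hne_zero
  refine hself.not_gt ?_
  simpa using ENNReal.mul_lt_mul_left hne_zero hne_top hc

end StayProb

section StopOn

variable {S : Type*} [MeasurableSpace S] {P : Kernel S S} {C F : Set S} {s : S}

open Classical in
/-- The transition kernel of the chain that moves according to `P` until it reaches `F` and stays
where it is from then on. Its probability of never leaving `C` is the probability that the original
chain reaches `F` before leaving `C` or never leaves `C`. -/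
noncomputable def stopOn (P : Kernel S S) (hF : MeasurableSet F) : Kernel S S :=
  Kernel.piecewise hF Kernel.id P

lemma stopOn_of_mem (hF : MeasurableSet F) (hs : s ∈ F) : stopOn P hF s = Measure.dirac s := by
  simp [stopOn, Kernel.piecewise_apply, hs, Kernel.id_apply]

lemma stopOn_of_notMem (hF : MeasurableSet F) (hs : s ∉ F) : stopOn P hF s = P s := by
  simp [stopOn, Kernel.piecewise_apply, hs]

lemma stayForeverProb_stopOn_of_mem (hC : MeasurableSet C) (hF : MeasurableSet F) (hsC : s ∈ C)
    (hsF : s ∈ F) : stayForeverProb (stopOn P hF) C s = 1 := by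
  have hstay (n : ℕ) : stayProb (stopOn P hF) C n s = 1 := by
    induction n with
    | zero => rfl
    | succ n ih =>
      rw [stayProb_succ_of_mem hsC, stopOn_of_mem hF hsF,
        lintegral_dirac' _ (measurable_stayProb hC n), ih]
  simp [stayForeverProb, hstay]

variable [IsMarkovKernel P]

instance (hF : MeasurableSet F) : IsMarkovKernel (stopOn P hF) := by
  unfold stopOn
  infer_instance

lemma lintegral_stayForeverProb_stopOn_le (hC : MeasurableSet C) (hF : MeasurableSet F)
    (hs : s ∈ C) :
    ∫⁻ u, stayForeverProb (stopOn P hF) C u ∂(P s) ≤ stayForeverProb (stopOn P hF) C s := by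
  by_cases hsF : s ∈ F
  · rw [stayForeverProb_stopOn_of_mem hC hF hs hsF]
    exact (lintegral_mono stayForeverProb_le_one).trans_eq (by simp)
  · rw [← stopOn_of_notMem (P := P) hF hsF, lintegral_stayForeverProb hC hs]

variable {F : ℕ → Set S} (hF : ∀ n, MeasurableSet (F n)) (hescape : ∀ s, ∀ᶠ n in atTop, s ∉ F n)

include hescape in
lemma tendsto_stayProb_stopOn (hC : MeasurableSet C) (j : ℕ) (s : S) :
    Tendsto (fun n => stayProb (stopOn P (hF n)) C j s) atTop (𝓝 (stayProb P C j s)) := by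
  induction j generalizing s with
  | zero => exact tendsto_const_nhds
  | succ j ih =>
    by_cases hs : s ∈ C
    · have hstep : ∀ᶠ n in atTop, ∫⁻ u, stayProb (stopOn P (hF n)) C j u ∂(P s) =
          stayProb (stopOn P (hF n)) C (j + 1) s := by
        filter_upwards [hescape s] with n hn
        rw [stayProb_succ_of_mem hs, stopOn_of_notMem (hF n) hn]
      rw [stayProb_succ_of_mem hs]
      refine Tendsto.congr' hstep ?_
      exact tendsto_lintegral_of_dominated_convergence 1 (fun n => measurable_stayProb hC j)
        (fun n => ae_of_all _ (stayProb_le_one j)) (by simp) (ae_of_all _ ih)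
    · simp [stayProb_succ_of_notMem hs]

include hescape in
lemma tendsto_stayForeverProb_stopOn_zero (hC : MeasurableSet C) (hs : stayForeverProb P C s = 0) :
    Tendsto (fun n => stayForeverProb (stopOn P (hF n)) C s) atTop (𝓝 0) := by
  rw [ENNReal.tendsto_nhds_zero]
  intro ε hε
  obtain ⟨j, hj⟩ : ∃ j, stayProb P C j s < ε :=
    ((tendsto_stayProb s).eventually_lt_const (by rwa [hs])).exists
  filter_upwards [(tendsto_stayProb_stopOn hF hescape hC j s).eventually_lt_const hj] with n hn
  exact (stayForeverProb_le_stayProb j s).trans hn.le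

end StopOn

section PathMeasure

variable {S : Type*} [MeasurableSpace S] {μ : Measure S} [IsProbabilityMeasure μ] {P : Kernel S S}
  [IsMarkovKernel P] {C : Set S}

instance : IsProbabilityMeasure (pathMeasure μ P) := by
  unfold pathMeasure
  infer_instance

lemma pathMeasure_map_zero : (pathMeasure μ P).map (fun ω => ω 0) = μ := by
  have heval : (fun ω : ℕ → S => ω 0) = (fun x : Finset.Iic 0 → S => x ⟨0, by simp⟩) ∘
      Preorder.frestrictLe (π := fun _ => S) 0 := rfl
  rw [heval, ← Measure.map_map (by fun_prop) (by fun_prop), pathMeasure, Kernel.trajMeasure,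
    Measure.map_comp _ _ (by fun_prop), Kernel.traj_map_frestrictLe, Kernel.partialTraj_self,
    Measure.id_comp, Measure.map_map (by fun_prop) (MeasurableEquiv.measurable _)]
  exact Measure.map_id

lemma setLIntegral_pathMeasure_succ {n : ℕ} {E : Set (ℕ → S)}
    (hE : MeasurableSet[Filtration.piLE n] E) {g : S → ℝ≥0∞} (hg : Measurable g) :
    ∫⁻ ω in E, g (ω (n + 1)) ∂(pathMeasure μ P) =
      ∫⁻ ω in E, ∫⁻ u, g u ∂(P (ω n)) ∂(pathMeasure μ P) := by
  rw [Filtration.piLE_eq_comap_frestrictLe] at hE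
  obtain ⟨E, hE, rfl⟩ := hE
  have hdisint := congrArg (fun ν => ∫⁻ x in E ×ˢ Set.univ, g x.2 ∂ν)
    (Kernel.map_frestrictLe_trajMeasure_compProd_eq_map_trajMeasure
      (X := fun _ : ℕ => S) (μ₀ := μ) (a := n)
      (κ := fun n => P.comap (fun x : (Finset.Iic n → S) => x ⟨n, Finset.mem_Iic.2 le_rfl⟩)
        (measurable_pi_apply _)))
  have hmean : Measurable fun x : Finset.Iic n → S =>
      ∫⁻ u, g u ∂(P (x ⟨n, Finset.mem_Iic.2 le_rfl⟩)) :=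
    hg.lintegral_kernel.comp (measurable_pi_apply _)
  rw [Measure.setLIntegral_compProd (by fun_prop) hE .univ] at hdisint
  simp only [setLIntegral_univ, Kernel.comap_apply] at hdisint
  rw [setLIntegral_map hE hmean (by fun_prop),
    setLIntegral_map (hE.prod .univ) (by fun_prop) (by fun_prop)] at hdisint
  rw [Set.prod_univ] at hdisint
  exact hdisint.symm

lemma pathMeasure_map_succ (n : ℕ) :
    (pathMeasure μ P).map (fun ω => ω (n + 1)) =
      P ∘ₘ (pathMeasure μ P).map (fun ω => ω n) := by
  ext t ht
  have hstep := setLIntegral_pathMeasure_succ (μ := μ) (P := P) (n := n) (E := Set.univ) .univ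
    (measurable_one.indicator ht)
  simp_rw [setLIntegral_univ, lintegral_indicator_one ht] at hstep
  rw [Measure.bind_apply ht P.aemeasurable, lintegral_map (P.measurable_coe ht) (by fun_prop),
    ← hstep, ← lintegral_indicator_one ht, lintegral_map (by fun_prop) (by fun_prop)]

lemma measurableSet_piLE_pi_Ico (hC : MeasurableSet C) (k n : ℕ) :
    MeasurableSet[Filtration.piLE n] ((Set.Ico k (n + 1)).pi fun _ : ℕ => C) := by
  rw [Filtration.piLE_eq_comap_frestrictLe]
  refine ⟨{x | ∀ m, k ≤ m.1 → x m ∈ C}, ?_, ?_⟩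
  · simp only [Set.ofPred_forall]
    exact .iInter fun m => .iInter fun _ => measurable_pi_apply m hC
  · ext ω
    simp only [Set.mem_preimage, Set.mem_ofPred_eq, Set.mem_pi, Set.mem_Ico, Order.lt_add_one_iff]
    exact ⟨fun h m hm => h ⟨m, Finset.mem_Iic.2 hm.2⟩ hm.1,
      fun h m hm => h m ⟨hm, Finset.mem_Iic.1 m.2⟩⟩

lemma setLIntegral_pi_Ico_stayProb (hC : MeasurableSet C) (n j l : ℕ) :
    ∫⁻ ω in (Set.Ico n (n + j)).pi fun _ => C, stayProb P C l (ω (n + j)) ∂(pathMeasure μ P) =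
      ∫⁻ ω, stayProb P C (l + j) (ω n) ∂(pathMeasure μ P) := by
  induction j generalizing l with
  | zero => simp
  | succ j ih =>
    have hstep : (Set.Ico n (n + (j + 1))).pi (fun _ => C) =
        (fun ω => ω (n + j)) ⁻¹' C ∩ (Set.Ico n (n + j)).pi fun _ => C := by
      rw [← add_assoc, ← Set.insert_Ico_right_eq_Ico_add_one (by lia), Set.insert_pi]
    calc ∫⁻ ω in (Set.Ico n (n + (j + 1))).pi fun _ => C, stayProb P C l (ω (n + j + 1))
          ∂(pathMeasure μ P)
        = ∫⁻ ω in (Set.Ico n (n + (j + 1))).pi fun _ => C,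
            ∫⁻ u, stayProb P C l u ∂(P (ω (n + j))) ∂(pathMeasure μ P) :=
          setLIntegral_pathMeasure_succ (measurableSet_piLE_pi_Ico hC n (n + j))
            (measurable_stayProb hC l)
      _ = ∫⁻ ω in (Set.Ico n (n + j)).pi fun _ => C, stayProb P C (l + 1) (ω (n + j))
            ∂(pathMeasure μ P) := by
          rw [hstep, ← setLIntegral_indicator (measurable_pi_apply _ hC)]
          rfl
      _ = ∫⁻ ω, stayProb P C (l + (j + 1)) (ω n) ∂(pathMeasure μ P) := by
          rw [ih, add_right_comm, add_assoc]

lemma pathMeasure_pi_Ici (hC : MeasurableSet C) (n : ℕ) :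
    pathMeasure μ P ((Set.Ici n).pi fun _ => C) =
      ∫⁻ ω, stayForeverProb P C (ω n) ∂(pathMeasure μ P) := by
  have hmeas (j : ℕ) : MeasurableSet ((Set.Ico n (n + j)).pi fun _ : ℕ => C) :=
    .pi (Set.to_countable _) fun _ _ => hC
  have hanti : Antitone fun j => (Set.Ico n (n + j)).pi fun _ : ℕ => C :=
    fun i j hij => Set.pi_mono' (fun _ _ => le_rfl) (Set.Ico_subset_Ico_right (by lia))
  have hInter : (Set.Ici n).pi (fun _ : ℕ => C) = ⋂ j, (Set.Ico n (n + j)).pi fun _ => C := by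
    ext ω
    simp only [Set.mem_pi, Set.mem_iInter, Set.mem_Ici, Set.mem_Ico]
    exact ⟨fun h j m hm => h m hm.1, fun h m hm => h (m + 1) m ⟨hm, by lia⟩⟩
  calc pathMeasure μ P ((Set.Ici n).pi fun _ => C)
      = ⨅ j, pathMeasure μ P ((Set.Ico n (n + j)).pi fun _ => C) := by
        rw [hInter, hanti.measure_iInter (fun j => (hmeas j).nullMeasurableSet)
          ⟨0, measure_ne_top _ _⟩]
    _ = ⨅ j, ∫⁻ ω, stayProb P C j (ω n) ∂(pathMeasure μ P) := by
        refine iInf_congr fun j => ?_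
        simpa using setLIntegral_pi_Ico_stayProb (μ := μ) (P := P) hC n j 0
    _ = ∫⁻ ω, stayForeverProb P C (ω n) ∂(pathMeasure μ P) := by
        rw [← lintegral_map (measurable_stayForeverProb hC) (measurable_pi_apply n),
          lintegral_stayForeverProb_eq_iInf _ hC]
        exact iInf_congr fun j =>
          (lintegral_map (measurable_stayProb hC j) (measurable_pi_apply n)).symm

end PathMeasure

section Reachable

variable {S : Type*} [MeasurableSpace S]

/-- The states that the chain with initial distribution `μ` visits with positive probability at
some time; on a countable state space they form the smallest supporting invariant. -/
def reachable (μ : Measure S) [IsProbabilityMeasure μ] (P : Kernel S S) [IsMarkovKernel P] :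
    Set S :=
  {s | ∃ n : ℕ, (pathMeasure μ P).map (fun ω => ω n) {s} ≠ 0}

variable [Countable S] [DiscreteMeasurableSpace S] {μ : Measure S} [IsProbabilityMeasure μ]
  {P : Kernel S S} [IsMarkovKernel P]

lemma forall_ae_pathMeasure_iff {p : S → Prop} :
    (∀ n : ℕ, ∀ᵐ ω ∂(pathMeasure μ P), p (ω n)) ↔ ∀ s ∈ reachable μ P, p s := by
  have hmap (n : ℕ) : (∀ᵐ ω ∂(pathMeasure μ P), p (ω n)) ↔
      ∀ s, (pathMeasure μ P).map (fun ω => ω n) {s} ≠ 0 → p s := by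
    have heval : Measurable fun ω : ℕ → S => ω n := measurable_pi_apply n
    rw [← ae_iff_of_countable, ae_map_iff heval.aemeasurable .of_discrete]
  simp_rw [hmap]
  exact ⟨fun h s ⟨n, hn⟩ => h n s hn, fun h n s hn => h s ⟨n, hn⟩⟩

lemma ae_pathMeasure_mem_reachable (n : ℕ) :
    ∀ᵐ s ∂(pathMeasure μ P).map (fun ω => ω n), s ∈ reachable μ P :=
  (ae_map_iff (measurable_pi_apply n).aemeasurable .of_discrete).2
    (forall_ae_pathMeasure_iff.2 (fun _ hs => hs) n)

lemma ae_mem_reachable : ∀ᵐ s ∂μ, s ∈ reachable μ P := by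
  simpa only [pathMeasure_map_zero] using ae_pathMeasure_mem_reachable (μ := μ) (P := P) 0

lemma ae_kernel_mem_reachable :
    ∀ s ∈ reachable μ P, ∀ᵐ u ∂(P s), u ∈ reachable μ P := by
  refine forall_ae_pathMeasure_iff.1 fun n => ?_
  have hnext : ∀ᵐ s ∂(pathMeasure μ P).map (fun ω => ω n), ∀ᵐ u ∂(P s), u ∈ reachable μ P := by
    refine Measure.ae_ae_of_ae_comp ?_
    rw [← pathMeasure_map_succ]
    exact ae_pathMeasure_mem_reachable (n + 1)
  exact ae_of_ae_map (measurable_pi_apply n).aemeasurable hnext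

lemma ae_frequently_notMem_iff {C : Set S} :
    (∀ᵐ ω ∂(pathMeasure μ P), ∃ᶠ m in atTop, ω m ∉ C) ↔
      ∀ s ∈ reachable μ P, stayForeverProb P C s = 0 := by
  have hC : MeasurableSet C := .of_discrete
  have hleave (n : ℕ) : (∀ᵐ ω ∂(pathMeasure μ P), ∃ m ≥ n, ω m ∉ C) ↔
      ∀ᵐ ω ∂(pathMeasure μ P), stayForeverProb P C (ω n) = 0 := by
    have hcompl : {ω : ℕ → S | ¬∃ m ≥ n, ω m ∉ C} = (Set.Ici n).pi fun _ => C := by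
      ext ω
      simp [Set.mem_pi]
    have hmeas : Measurable fun ω : ℕ → S => stayForeverProb P C (ω n) :=
      (measurable_stayForeverProb hC).comp (measurable_pi_apply n)
    rw [ae_iff, hcompl, pathMeasure_pi_Ici hC, lintegral_eq_zero_iff hmeas]
    rfl
  rw [← forall_ae_pathMeasure_iff (p := fun s => stayForeverProb P C s = 0)]
  simp only [frequently_atTop, ae_all_iff, hleave]

end Reachable

section Termination

variable {S : Type*} [MeasurableSpace S] {P : Kernel S S} {C : Set S}

/-- The almost-sure termination part of the proof rule for the set `C` of states at which the
chain has not terminated yet. -/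
structure TerminationCertificate (P : Kernel S S) (C : Set S) (W : S → ℝ≥0) (d p : ℝ≥0 → ℝ≥0) :
    Prop where
  post_lt_top : ∀ s, postExp P W s < ∞
  pos : ∀ s ∈ C, 0 < W s
  eq_zero : ∀ s ∉ C, W s = 0
  post_le : ∀ s ∈ C, postExp P W s ≤ W s
  d_antitone : Antitone d
  p_antitone : Antitone p
  d_pos : ∀ r, 0 < d r
  p_pos : ∀ r, 0 < p r
  p_le_one : ∀ r, p r ≤ 1
  drift : ∀ s ∈ C,
    (p (W s) : ℝ≥0∞) ≤ P s {u | (W u : ℝ) ≤ (W s : ℝ) - (d (W s) : ℝ)}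

lemma postExp_lt_top_of_le [IsFiniteKernel P] {V : S → ℝ≥0} {c : ℝ≥0} (hV : ∀ u, V u ≤ c) (s : S) :
    postExp P V s < ∞ :=
  calc postExp P V s ≤ ∫⁻ _, c ∂(P s) := lintegral_mono fun u => ENNReal.coe_le_coe.2 (hV u)
    _ < ∞ := by simp [ENNReal.mul_lt_top]

variable [IsMarkovKernel P]

/-- A nonnegative function lies below its mean with positive probability, so at `s` the decrease
`W s - PW(s)` is attained with positive probability; only finitely many states compete at each
level of `W`. -/
lemma TerminationCertificate.exists_of_postExp_lt {W : S → ℝ≥0} (hW : Measurable W)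
    (hfin : ∀ s, postExp P W s < ∞) (hzero : ∀ s ∉ C, W s = 0)
    (hlt : ∀ s ∈ C, postExp P W s < W s) (hsub : ∀ r, {s ∈ C | W s ≤ r}.Finite) :
    ∃ d p, TerminationCertificate P C W d p := by
  let mean (s : S) : ℝ≥0 := (postExp P W s).toNNReal
  have hmean (s : S) : (mean s : ℝ≥0∞) = postExp P W s := ENNReal.coe_toNNReal (hfin s).ne
  have hmean_lt : ∀ s ∈ C, mean s < W s := fun s hs => by exact_mod_cast hmean s ▸ hlt s hs
  have hmean_pos (s : S) : 0 < P s {u | W u ≤ mean s} := by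
    have hle := measure_le_lintegral_pos (μ := P s) hW.coe_nnreal_ennreal.aemeasurable
    change 0 < P s {u | (W u : ℝ≥0∞) ≤ postExp P W s} at hle
    simpa only [← hmean, ENNReal.coe_le_coe] using hle
  obtain ⟨d, hd_anti, hd_pos, -, hd⟩ := exists_antitone_pos_le_comp hsub
    fun s hs => tsub_pos_of_lt (hmean_lt s hs)
  obtain ⟨p, hp_anti, hp_pos, hp_one, hp⟩ := exists_antitone_pos_le_comp hsub
    (δ := fun s => (P s {u | W u ≤ mean s}).toNNReal)
    fun s _ => ENNReal.toNNReal_pos (hmean_pos s).ne' (measure_ne_top _ _)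
  refine ⟨d, p, hfin, fun s hs => zero_le.trans_lt (hmean_lt s hs), hzero,
    fun s hs => (hlt s hs).le, hd_anti, hp_anti, hd_pos, hp_pos, hp_one, fun s hs => ?_⟩
  calc (p (W s) : ℝ≥0∞) ≤ ((P s {u | W u ≤ mean s}).toNNReal : ℝ≥0) := by exact_mod_cast hp s hs
    _ = P s {u | W u ≤ mean s} := ENNReal.coe_toNNReal (measure_ne_top _ _)
    _ ≤ P s {u | (W u : ℝ) ≤ (W s : ℝ) - (d (W s) : ℝ)} := measure_mono fun u hu => ?_
  have hd_real : (d (W s) : ℝ) ≤ W s - mean s := by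
    rw [← NNReal.coe_sub (hmean_lt s hs).le]
    exact_mod_cast hd s hs
  have hu_real : (W u : ℝ) ≤ mean s := by exact_mod_cast hu
  change (W u : ℝ) ≤ W s - d (W s)
  linarith

lemma exists_stayProb_succ_lt {s : S} (hs : s ∈ C) (hlt : stayForeverProb P C s < 1) :
    ∃ j, stayProb P C (j + 2) s < stayProb P C (j + 1) s := by
  by_contra! hmono
  have hone (j : ℕ) : 1 ≤ stayProb P C (j + 1) s := by
    induction j with
    | zero => exact (stayProb_one_of_mem hs).ge
    | succ j ih => exact ih.trans (hmono j)
  exact hlt.not_ge <| le_iInf fun j => (hone j).trans (antitone_stayProb P C j.le_succ s)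

lemma exists_bounded_strict_superharmonic (hC : MeasurableSet C)
    (hleave : ∀ s ∈ C, stayForeverProb P C s < 1) :
    ∃ G : S → ℝ≥0∞, (∀ s, G s ≤ 2) ∧ (∀ s ∉ C, G s = 0) ∧
      ∀ s ∈ C, ∫⁻ u, G u ∂(P s) < G s := by
  let G (s : S) : ℝ≥0∞ := ∑' j : ℕ, 2⁻¹ ^ j * stayProb P C (j + 1) s
  have hmeas (j : ℕ) : Measurable fun s => 2⁻¹ ^ j * stayProb P C (j + 1) s :=
    (measurable_stayProb hC (j + 1)).const_mul _
  have hpost (s : S) (hs : s ∈ C) :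
      ∫⁻ u, G u ∂(P s) = ∑' j : ℕ, 2⁻¹ ^ j * stayProb P C (j + 2) s := by
    rw [lintegral_tsum fun j => (hmeas j).aemeasurable]
    refine tsum_congr fun j => ?_
    rw [lintegral_const_mul _ (measurable_stayProb hC (j + 1)), stayProb_succ_of_mem hs (j + 1)]
  have hle (s : S) (k : ℕ) : ∑' j : ℕ, 2⁻¹ ^ j * stayProb P C (j + k) s ≤ 2 :=
    calc ∑' j : ℕ, 2⁻¹ ^ j * stayProb P C (j + k) s ≤ ∑' j : ℕ, (2⁻¹ : ℝ≥0∞) ^ j :=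
          ENNReal.tsum_le_tsum fun j => mul_le_of_le_one_right' (stayProb_le_one (j + k) s)
      _ = 2 := by rw [ENNReal.tsum_geometric, ENNReal.one_sub_inv_two, inv_inv]
  refine ⟨G, fun s => hle s 1,
    fun s hs => by simp [G, stayProb_succ_of_notMem hs], fun s hs => ?_⟩
  obtain ⟨i, hi⟩ := exists_stayProb_succ_lt hs (hleave s hs)
  rw [hpost s hs]
  refine ENNReal.tsum_lt_tsum (i := i) (ne_top_of_le_ne_top (by simp) (hle s 2)) (fun j => ?_) ?_
  · gcongr
    exact antitone_stayProb P C (j + 1).le_succ s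
  · exact ENNReal.mul_lt_mul_right (by simp) (by simp) hi

variable [Countable S] [DiscreteMeasurableSpace S]

/-- The `n`-th summand `u n` below is the probability of reaching the cofinite set `F n` before
leaving `C`; it is superharmonic on `C`, equal to `1` on `C ∩ F n`, and tends to `0` pointwise. -/
lemma exists_superharmonic_finite_sublevel (hleave : ∀ s, stayForeverProb P C s = 0) :
    ∃ H : S → ℝ≥0∞, (∀ s, H s ≠ ∞) ∧ (∀ s ∉ C, H s = 0) ∧ (∀ s, ∫⁻ u, H u ∂(P s) ≠ ∞) ∧
      (∀ s ∈ C, ∫⁻ u, H u ∂(P s) ≤ H s) ∧ ∀ m : ℕ, {s ∈ C | H s ≤ m}.Finite := by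
  have hC : MeasurableSet C := .of_discrete
  obtain ⟨code, hcode⟩ := Countable.exists_injective_nat S
  let F (n : ℕ) : Set S := (code ⁻¹' Set.Iio n)ᶜ
  have hF (n : ℕ) : MeasurableSet (F n) := .of_discrete
  have hescape (s : S) : ∀ᶠ n in atTop, s ∉ F n :=
    (eventually_gt_atTop (code s)).mono fun n hn => not_not_intro hn
  have hcofinite (n : ℕ) : (F n)ᶜ.Finite := by
    simpa only [F, compl_compl] using (Set.finite_Iio n).preimage hcode.injOn
  let u (n : ℕ) : S → ℝ≥0∞ := stayForeverProb (stopOn P (hF n)) C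
  have hu_lim (s : S) : Tendsto (fun n => u n s) atTop (𝓝 0) :=
    tendsto_stayForeverProb_stopOn_zero hF hescape hC (hleave s)
  have hpost_lim (s : S) : Tendsto (fun n => ∫⁻ v, u n v ∂(P s)) atTop (𝓝 0) := by
    simpa using tendsto_lintegral_of_dominated_convergence (μ := P s) 1 (fun n => .of_discrete)
      (fun n => ae_of_all _ stayForeverProb_le_one) (by simp) (ae_of_all _ hu_lim)
  obtain ⟨φ, hφ⟩ := exists_seq_forall_tsum_ne_top
    (x := fun s n => u n s + ∫⁻ v, u n v ∂(P s))
    (fun s n => ENNReal.add_ne_top.2 ⟨ne_top_of_le_ne_top (by simp) (stayForeverProb_le_one s),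
      ((lintegral_mono stayForeverProb_le_one).trans_lt (by simp)).ne⟩)
    (fun s => by simpa using (hu_lim s).add (hpost_lim s))
  have hpost (s : S) : ∫⁻ v, ∑' j, u (φ j) v ∂(P s) = ∑' j, ∫⁻ v, u (φ j) v ∂(P s) :=
    lintegral_tsum fun j => AEMeasurable.of_discrete
  simp only [ENNReal.tsum_add, ENNReal.add_ne_top, ← hpost] at hφ
  refine ⟨fun s => ∑' j, u (φ j) s, fun s => (hφ s).1,
    fun s hs => by simp [u, stayForeverProb_of_notMem hs], fun s => (hφ s).2, fun s hs => ?_,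
    finite_setOf_tsum_le_natCast (fun j => hcofinite (φ j))
      fun j _ hs hsF => stayForeverProb_stopOn_of_mem hC (hF (φ j)) hs hsF⟩
  rw [hpost]
  exact ENNReal.tsum_le_tsum fun j => lintegral_stayForeverProb_stopOn_le hC (hF (φ j)) hs

lemma TerminationCertificate.exists (hleave : ∀ s, stayForeverProb P C s = 0) :
    ∃ W d p, TerminationCertificate P C W d p := by
  obtain ⟨H, hH_fin, hH_zero, hH_post, hH_le, hH_sub⟩ := exists_superharmonic_finite_sublevel hleave
  obtain ⟨G, hG_le, hG_zero, hG_lt⟩ := exists_bounded_strict_superharmonic (P := P) (C := C)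
    .of_discrete fun s _ => by simp [hleave s]
  let W (s : S) : ℝ≥0 := (H s + G s).toNNReal
  have hW (s : S) : (W s : ℝ≥0∞) = H s + G s :=
    ENNReal.coe_toNNReal (ENNReal.add_ne_top.2 ⟨hH_fin s, ne_top_of_le_ne_top (by simp) (hG_le s)⟩)
  have hpost (s : S) : postExp P W s = ∫⁻ u, H u ∂(P s) + ∫⁻ u, G u ∂(P s) := by
    simp_rw [postExp, hW]
    exact lintegral_add_left .of_discrete _
  refine ⟨W, exists_of_postExp_lt .of_discrete (fun s => ?_)
    (fun s hs => by simp [W, hH_zero s hs, hG_zero s hs]) (fun s hs => ?_) fun r => ?_⟩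
  · rw [hpost]
    exact ENNReal.add_lt_top.2 ⟨(hH_post s).lt_top, (lintegral_mono hG_le).trans_lt (by simp)⟩
  · rw [hpost, hW]
    exact ENNReal.add_lt_add_of_le_of_lt (hH_post s) (hH_le s hs) (hG_lt s hs)
  · obtain ⟨m, hm⟩ := exists_nat_ge r
    refine (hH_sub m).subset fun s hs => ⟨hs.1, ?_⟩
    calc H s ≤ W s := by rw [hW]; exact le_self_add
      _ ≤ m := by exact_mod_cast hs.2.trans hm

end Termination

section Safety

variable {S : Type*} [MeasurableSpace S] {P : Kernel S S} {A I : Set S} {s : S}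

/-- The probability that the chain with transition kernel `P` started in `s` ever visits `A`; it
serves as the qualitative safety certificate. -/
noncomputable def hitProb (P : Kernel S S) (A : Set S) (s : S) : ℝ≥0 :=
  (1 - stayForeverProb P Aᶜ s).toNNReal

/-- The states of `I` from which `A` is visited with probability at most one half. The bound could
be any constant strictly between `0` and `1`. -/
def absorbingRegion (P : Kernel S S) (I A : Set S) : Set S :=
  {s ∈ I | hitProb P A s ≤ 1 / 2}

lemma coe_hitProb (s : S) : (hitProb P A s : ℝ≥0∞) = 1 - stayForeverProb P Aᶜ s :=
  ENNReal.coe_toNNReal (ENNReal.sub_ne_top (by simp))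

lemma hitProb_of_mem (hs : s ∈ A) : hitProb P A s = 1 := by
  simp [hitProb, stayForeverProb_of_notMem (Set.notMem_compl_iff.2 hs)]

lemma hitProb_le_one (s : S) : hitProb P A s ≤ 1 := by
  rw [← ENNReal.coe_le_coe, coe_hitProb]
  exact tsub_le_self

lemma absorbingRegion_subset : absorbingRegion P I A ⊆ I \ A := by
  refine fun s hs => ⟨hs.1, fun hA => ?_⟩
  have hhalf : (1 : ℝ≥0) ≤ 1 / 2 := (hitProb_of_mem hA).symm.trans_le hs.2
  exact hhalf.not_gt (NNReal.half_lt_self one_ne_zero)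

lemma stayForeverProb_compl (s : S) : stayForeverProb P Aᶜ s = 1 - hitProb P A s := by
  rw [coe_hitProb, ENNReal.sub_sub_cancel ENNReal.one_ne_top (stayForeverProb_le_one s)]

variable [IsMarkovKernel P]

lemma postExp_hitProb (hA : MeasurableSet A) (hs : s ∉ A) :
    postExp P (hitProb P A) s = hitProb P A s := by
  simp_rw [postExp, coe_hitProb]
  rw [lintegral_sub (measurable_stayForeverProb hA.compl)
    ((lintegral_mono stayForeverProb_le_one).trans_lt (by simp)).ne
    (ae_of_all _ stayForeverProb_le_one), lintegral_stayForeverProb hA.compl hs]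
  simp

end Safety

section Reactivity

variable {S : Type*} {A B I : Set S}

lemma mem_finVisits_iff {ω : ℕ → S} : ω ∈ finVisits A ↔ ∀ᶠ m in atTop, ω m ∉ A := by
  simp [finVisits, eventually_atTop]

lemma mem_infVisits_iff {ω : ℕ → S} : ω ∈ infVisits B ↔ ∃ᶠ m in atTop, ω m ∈ B := by
  simp [infVisits, frequently_atTop]

variable [MeasurableSpace S]

lemma measurableSet_reactivity {k : ℕ} {A B : Fin k → Set S} (hA : ∀ i, MeasurableSet (A i))
    (hB : ∀ i, MeasurableSet (B i)) : MeasurableSet (reactivity A B) :=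
  .iInter fun i => .union
    (.iUnion fun _ => .iInter fun m => .iInter fun _ =>
      measurable_pi_apply (X := fun _ => S) m (hA i).compl)
    (.iInter fun _ => .iUnion fun m => .iUnion fun _ =>
      measurable_pi_apply (X := fun _ => S) m (hB i))

lemma lintegral_indicator_compl_one (ν : Measure S) (hI : MeasurableSet I) :
    ∫⁻ u, ((Iᶜ.indicator (1 : S → ℝ≥0) u : ℝ≥0) : ℝ≥0∞) ∂ν = ν Iᶜ := by
  simp_rw [ENNReal.coe_indicator]
  exact lintegral_indicator_one hI.compl

variable {P : Kernel S S} [IsMarkovKernel P] [Countable S] [DiscreteMeasurableSpace S]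

lemma stayForeverProb_diff_absorbingRegion_eq_zero {μ : Measure S} [IsProbabilityMeasure μ]
    (hreact : ∀ᵐ ω ∂(pathMeasure μ P), ω ∈ finVisits A ∪ infVisits B) (s : S) :
    stayForeverProb P (reachable μ P \ (B ∪ absorbingRegion P (reachable μ P) A)) s = 0 := by
  set C := reachable μ P \ (B ∪ absorbingRegion P (reachable μ P) A)
  have hstay : ∀ s ∈ C \ A, stayForeverProb P (C \ A) s ≤ 1 - (1 / 2 : ℝ≥0) := by
    intro s hs
    have hhit : 1 / 2 ≤ hitProb P A s := le_of_not_ge fun h => hs.1.2 (.inr ⟨hs.1.1, h⟩)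
    calc stayForeverProb P (C \ A) s ≤ stayForeverProb P Aᶜ s :=
          stayForeverProb_mono_set (fun _ hu => hu.2) s
      _ = 1 - hitProb P A s := stayForeverProb_compl s
      _ ≤ 1 - (1 / 2 : ℝ≥0) := tsub_le_tsub_left (by exact_mod_cast hhit) 1
  have hleave : ∀ᵐ ω ∂(pathMeasure μ P), ∃ᶠ m in atTop, ω m ∉ C \ A :=
    ae_frequently_notMem_iff.2 fun s _ => stayForeverProb_eq_zero_of_le .of_discrete
      (ENNReal.sub_lt_self (by simp) (by simp) (by simp)) hstay s
  by_cases hs : s ∈ reachable μ P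
  · refine ae_frequently_notMem_iff.1 ?_ s hs
    filter_upwards [hreact, hleave] with ω hω hω_leave
    rcases hω with hfin | hinf
    · exact (hω_leave.and_eventually (mem_finVisits_iff.1 hfin)).mono
        fun m hm hmC => hm.1 ⟨hmC, hm.2⟩
    · exact (mem_infVisits_iff.1 hinf).mono fun m hmB hmC => hmC.2 (.inl hmB)
  · exact stayForeverProb_of_notMem fun h => hs h.1

lemma exists_proofRuleTwo {k : ℕ} {A B : Fin k → Set S} (hI : ∀ s ∈ I, ∀ᵐ u ∂(P s), u ∈ I)
    (hleave : ∀ i s, stayForeverProb P (I \ (B i ∪ absorbingRegion P I (A i))) s = 0) :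
    ∃ W d p, ProofRuleTwo P A B I (Iᶜ.indicator 1) (fun i => absorbingRegion P I (A i))
      (fun i => hitProb P (A i)) W d p := by
  choose W d p hW using fun i => TerminationCertificate.exists (hleave i)
  refine ⟨W, d, p,
    { post_V₀_lt_top := postExp_lt_top_of_le
        fun u => Set.indicator_le_self' (fun _ _ => zero_le) u
      post_V_lt_top := fun i => postExp_lt_top_of_le hitProb_le_one
      post_W_lt_top := fun i => (hW i).post_lt_top
      d_pos := fun i => (hW i).d_pos
      p_pos := fun i => (hW i).p_pos
      p_le_one := fun i => (hW i).p_le_one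
      absorbing_subset := fun i => absorbingRegion_subset
      V_post := fun i s hs => (postExp_hitProb .of_discrete hs).le
      V_ge_one := fun i s hs => (hitProb_of_mem hs).ge
      V_gap := fun i => ⟨1 / 2, by norm_num, fun s hs => ?_⟩
      W_pos := fun i => (hW i).pos
      W_zero := fun i s hs => (hW i).eq_zero s fun hC => hC.2 hs.2
      W_post := fun i => (hW i).post_le
      W_drift := by rintro i r - s hs rfl; exact (hW i).drift s hs
      p_antitone := fun i _ _ _ _ hr => (hW i).p_antitone hr
      d_antitone := fun i _ _ _ _ hr => (hW i).d_antitone hr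
      V₀_post := fun s hs => ?_
      V₀_ge_one := fun s hs => by simp [hs] }⟩
  · have hhalf : (hitProb P (A i) s : ℝ) ≤ (1 / 2 : ℝ≥0) := by exact_mod_cast hs.2
    norm_num at hhalf ⊢
    exact hhalf
  · have hzero : postExp P (Iᶜ.indicator 1) s = 0 :=
      (lintegral_indicator_compl_one (P s) .of_discrete).trans (hI s hs)
    simp [hzero]

end Reactivity

end StreettChain

open StreettChain in
theorem mainTheorem12 {S : Type*} [Countable S] [MeasurableSpace S] [DiscreteMeasurableSpace S]
    (μ : Measure S) [IsProbabilityMeasure μ] (P : Kernel S S) [IsMarkovKernel P]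
    {k : ℕ} (A B : Fin k → Set S)
    (h : pathMeasure μ P (reactivity A B) = 1) :
    ∃ (I : Set S) (V₀ : S → ℝ≥0) (J : Fin k → Set S) (V W : Fin k → S → ℝ≥0)
      (d p : Fin k → ℝ≥0 → ℝ≥0),
      ProofRuleTwo P A B I V₀ J V W d p ∧ initExp μ V₀ = 0 := by
  have hreact : ∀ᵐ ω ∂(pathMeasure μ P), ω ∈ reactivity A B :=
    (mem_ae_iff_prob_eq_one
      (measurableSet_reactivity (fun _ => .of_discrete) fun _ => .of_discrete)).2 h
  obtain ⟨W, d, p, hrule⟩ := exists_proofRuleTwo (ae_kernel_mem_reachable (μ := μ) (P := P))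
    fun i => stayForeverProb_diff_absorbingRegion_eq_zero
      (hreact.mono fun ω hω => Set.mem_iInter.1 hω i)
  exact ⟨reachable μ P, _, _, _, W, d, p, hrule,
    (lintegral_indicator_compl_one μ .of_discrete).trans ae_mem_reachable⟩
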